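/- Let $\mathfrak{c}=2^{\aleph_0}$, and regard the graph $\Gamma_f=\{(x,f(x)) : x\in\mathbb{R}\}$ of a function $f:\mathbb{R}\to\mathbb{R}$ as a subspace of the Euclidean plane $\mathbb{R}^2$. There is a set $\mathcal{F}$ of functions $\mathbb{R}\to\mathbb{R}$ with $|\mathcal{F}|=2^{\mathfrak{c}}$ such that: (a) for every $f\in\mathcal{F}$ the graph $\Gamma_f$ is connected, dense in $\mathbb{R}^2$, and massive, i.e. $\Gamma_f\cap L\neq\emptyset$ for every Lebesgue measurable set $L\subset\mathbb{R}^2$ of positive Lebesgue measure; (b) the graphs are incomparable: for all $f,g\in\mathcal{F}$ (including $f=g$) and every subset $S\subset\Gamma_g$, if $\Gamma_f$ is homeomorphic to the subspace $S$, then $\Gamma_f=S=\Gamma_g$. In other words, no $\Gamma_f$ is homeomorphic to a proper subspace of itself, or to any subspace of $\Gamma_g$ for another $g\in\mathcal{F}$. -/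

import Mathlib

open Set MeasureTheory Cardinal

/-- The graph of a real function, as a subset of the Euclidean plane `ℝ × ℝ`; its topology is
the subspace topology. -/
def realGraph (f : ℝ → ℝ) : Set (ℝ × ℝ) := {p | p.2 = f p.1}

/-- A family of subspaces `A i` of a topological space is incomparable if `A i` is homeomorphic to
a subspace `S` of `A j` only in the trivial case `A i = S = A j`. -/
def Incomparable {X ι : Type*} [TopologicalSpace X] (A : ι → Set X) : Prop :=
  ∀ i j : ι, ∀ S : Set X, S ⊆ A j → Nonempty (A i ≃ₜ S) → A i = S ∧ S = A j

/-- A subset of the plane is massive if it meets every Lebesgue measurable set of positive Lebesgue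
measure. (`NullMeasurableSet L volume` says that `L` is Lebesgue measurable: a Borel set up to a
null set.) -/
def IsMassive (A : Set (ℝ × ℝ)) : Prop :=
  ∀ L : Set (ℝ × ℝ), NullMeasurableSet L volume → 0 < volume L → (A ∩ L).Nonempty

open Filter Topology

/-! A continuous map from a graph into the plane is determined on a countable dense set, so 𝔠 codes
`u` describe all of them. A transfinite recursion of length 𝔠 defeats each relevant code by putting
a point `p` into every graph and keeping its image out of every graph. It also makes the graphs meet
each closed set whose projection has size 𝔠, and reserves 𝔠 abscissae with a free value 0 or 1,
whence 2^𝔠 functions.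

Meeting these closed sets yields massiveness, density and connectedness. An embedding of one graph
into another that is not the identity moves every point of a nonempty relatively open piece, which
has 𝔠 points, so its code was defeated. An inclusion between graphs is an equality. -/

/-! ### Transfinite diagonalisation -/

/-- Transfinite selection: if each of the sets `T α` has at least `κ` elements, initial segments of
the index set are smaller than `κ`, and every earlier choice excludes only countably many elements,
then elements can be chosen without conflicts. -/
theorem exists_choice_of_countable_conflicts {I X : Type} [LinearOrder I] [WellFoundedLT I]
    [Nonempty X] {κ : Cardinal.{0}} (hκ : ℵ₀ < κ) (hI : ∀ α : I, #(Iio α) < κ)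
    (T : I → Set X) (hT : ∀ α, κ ≤ #(T α)) (C : I → I → X → X → Prop)
    (hC : ∀ α β s, {t ∈ T α | C α β t s}.Countable) :
    ∃ t : I → X, ∀ α, t α ∈ T α ∧ ∀ β < α, ¬ C α β (t α) (t β) := by
  classical
  have key : ∀ (α : I) (prev : ∀ β, β < α → X),
      ∃ x ∈ T α, ∀ β (hβ : β < α), ¬ C α β x (prev β hβ) := by
    intro α prev
    by_contra! hcon
    have hsub : T α ⊆ ⋃ β : Iio α, {t ∈ T α | C α β t (prev β β.2)} := by
      intro x hx
      obtain ⟨β, hβ, hc⟩ := hcon x hx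
      exact mem_iUnion.2 ⟨⟨β, hβ⟩, hx, hc⟩
    have h1 : #(⋃ β : Iio α, {t ∈ T α | C α β t (prev β β.2)}) ≤ #(Iio α) * ℵ₀ :=
      (mk_iUnion_le _).trans <| mul_le_mul' le_rfl <| ciSup_le' fun β =>
        le_aleph0_iff_set_countable.2 (hC α β _)
    exact absurd (((hT α).trans (mk_le_mk_of_subset hsub)).trans h1)
      (not_le.2 (mul_lt_of_lt hκ.le (hI α) hκ))
  choose g hg using key
  refine ⟨(wellFounded_lt (α := I)).fix g, fun α => ?_⟩
  rw [WellFounded.fix_eq]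
  exact ⟨(hg α _).1, fun β hβ => (hg α _).2 β hβ⟩

theorem exists_wellOrder_mk_Iio_lt (I : Type) :
    ∃ (_ : LinearOrder I) (_ : WellFoundedLT I), ∀ α : I, #(Iio α) < #I := by
  let e : I ≃ (#I).ord.ToType := (Cardinal.eq.1 (by simp)).some
  let L : LinearOrder I := LinearOrder.lift' e e.injective
  have hlt : ∀ a b : I, a < b ↔ e a < e b := fun a b => Iff.rfl
  refine ⟨L, ⟨InvImage.wf e wellFounded_lt⟩, fun α => ?_⟩
  have h : #(Iio α) ≤ #(Iio (e α)) :=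
    mk_le_of_injective (f := fun x : Iio α => (⟨e x, (hlt _ _).1 x.2⟩ : Iio (e α)))
      fun x y hxy => Subtype.ext (e.injective (congrArg Subtype.val hxy))
  exact h.trans_lt ((mk_Iio_lt (e α) (by simp)).trans_eq (by simp))

/-- Diagonalisation: given at most `𝔠` maps `h j`, each injective and fixed point free on a set `T j`
of `𝔠` points with distinct abscissae, there are `2 ^ 𝔠` functions all of whose graphs contain a
common point `p j ∈ T j` and omit its image under `h j`. -/
theorem exists_injective_family_diagonalizing {J : Type} (hJ : #J ≤ 𝔠) (T : J → Set (ℝ × ℝ))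
    (h : J → ℝ × ℝ → ℝ × ℝ) (hT : ∀ j, 𝔠 ≤ #(T j)) (hfst : ∀ j, InjOn Prod.fst (T j))
    (hinj : ∀ j, InjOn (h j) (T j)) (hne : ∀ j, ∀ p ∈ T j, h j p ≠ p) :
    ∃ f : Set ℝ → ℝ → ℝ, Function.Injective f ∧ ∃ p : J → ℝ × ℝ, ∀ j, p j ∈ T j ∧
      ∀ A, p j ∈ realGraph (f A) ∧ h j (p j) ∉ realGraph (f A) := by
  classical
  have hcard : #(J ⊕ ℝ) = 𝔠 := by
    rw [mk_sum, lift_id, lift_id, mk_real]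
    exact add_eq_right aleph0_le_continuum hJ
  obtain ⟨_, _, hIio⟩ := exists_wellOrder_mk_Iio_lt (J ⊕ ℝ)
  rw [hcard] at hIio
  -- The extra indices `z : ℝ` pick points on the x-axis; the value there encodes whether `z ∈ A`.
  let T' : J ⊕ ℝ → Set (ℝ × ℝ) := Sum.elim T fun _ => {p | p.2 = 0}
  let h' : J ⊕ ℝ → ℝ × ℝ → ℝ × ℝ := Sum.elim h fun _ p => p
  have hT' : ∀ α, 𝔠 ≤ #(T' α) := by
    rintro (j | z)
    · exact hT j
    · rw [← mk_real]
      exact mk_le_of_injective (f := fun x : ℝ => (⟨(x, 0), rfl⟩ : {p : ℝ × ℝ | p.2 = 0}))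
        fun x y hxy => congrArg (fun q => q.1.1) hxy
  have hfst' : ∀ α, InjOn Prod.fst (T' α) := by
    rintro (j | z)
    · exact hfst j
    · intro p hp q hq hpq
      exact Prod.ext hpq ((hp : p.2 = 0).trans (hq : q.2 = 0).symm)
  have hinj' : ∀ α, InjOn (h' α) (T' α) := by
    rintro (j | z)
    · exact hinj j
    · exact fun p _ q _ hpq => hpq
  let up : ℝ × ℝ → ℝ × ℝ := fun s => (s.1, s.2 + 1)
  have hfib : ∀ {Y : Type} (φ : ℝ × ℝ → Y) (α) (_ : InjOn φ (T' α)) (y : Y),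
      {t ∈ T' α | φ t = y}.Countable := fun φ α hφ y =>
    Set.Subsingleton.countable fun a ha b hb => hφ ha.1 hb.1 (ha.2.trans hb.2.symm)
  obtain ⟨p, hp⟩ := exists_choice_of_countable_conflicts aleph0_lt_continuum hIio T' hT'
    -- Call `h' β s` forbidden. A new point must avoid old abscissae, chosen or forbidden; its image
    -- must avoid each old point with bit 0 or 1, and the point 1 above each old forbidden one.
    (fun α β t s => t.1 = s.1 ∨ t.1 = (h' β s).1 ∨ h' α t = s ∨ h' α t = up s ∨
      h' α t = up (h' β s)) (by
      intro α β s
      refine ((hfib Prod.fst α (hfst' α) s.1).union <|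
        (hfib Prod.fst α (hfst' α) (h' β s).1).union <|
        (hfib _ α (hinj' α) s).union <| (hfib _ α (hinj' α) (up s)).union <|
        hfib _ α (hinj' α) (up (h' β s))).mono ?_
      rintro t ⟨ht, hc⟩
      rcases hc with hc | hc | hc | hc | hc
      · exact Or.inl ⟨ht, hc⟩
      · exact Or.inr (Or.inl ⟨ht, hc⟩)
      · exact Or.inr (Or.inr (Or.inl ⟨ht, hc⟩))
      · exact Or.inr (Or.inr (Or.inr (Or.inl ⟨ht, hc⟩)))
      · exact Or.inr (Or.inr (Or.inr (Or.inr ⟨ht, hc⟩))))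
  simp only [not_or] at hp
  have hpinj : ∀ α β, (p α).1 = (p β).1 → α = β := by
    intro α β hab
    rcases lt_trichotomy α β with hlt | heq | hlt
    · exact absurd hab.symm ((hp β).2 α hlt).1
    · exact heq
    · exact absurd hab ((hp α).2 β hlt).1
  let v : Set ℝ → J ⊕ ℝ → ℝ := fun A => Sum.elim (fun _ => 0) fun z => if z ∈ A then 1 else 0
  -- Over an abscissa carrying only forbidden points, the value lies 1 above the earliest of them;
  -- the last conflict keeps later forbidden points off it.
  let f : Set ℝ → ℝ → ℝ := fun A x =>
    if hx : ∃ α, (p α).1 = x then (p hx.choose).2 + v A hx.choose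
    else if hx : ∃ α, (h' α (p α)).1 = x ∧ ∀ β, (h' β (p β)).1 = x → ¬ β < α then
      (h' hx.choose (p hx.choose)).2 + 1
    else 0
  have hfp : ∀ A α, f A (p α).1 = (p α).2 + v A α := by
    intro A α
    have hx : ∃ β, (p β).1 = (p α).1 := ⟨α, rfl⟩
    have hc : hx.choose = α := hpinj _ _ hx.choose_spec
    simp only [f, dif_pos hx, hc]
  refine ⟨f, ?_, fun j => p (Sum.inl j), fun j => ⟨(hp (Sum.inl j)).1, fun A => ⟨?_, ?_⟩⟩⟩
  · intro A B hAB
    ext z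
    have hz := congrFun hAB (p (Sum.inr z)).1
    rw [hfp, hfp] at hz
    have hz' : (if z ∈ A then (1 : ℝ) else 0) = if z ∈ B then 1 else 0 := add_left_cancel hz
    by_cases hA : z ∈ A <;> by_cases hB : z ∈ B <;> simp [hA, hB] at hz' ⊢
  · change (p (Sum.inl j)).2 = f A (p (Sum.inl j)).1
    rw [hfp]
    simp [v]
  · intro hmem
    set α : J ⊕ ℝ := Sum.inl j with hα
    change h' α (p α) ∈ realGraph (f A) at hmem
    replace hmem : (h' α (p α)).2 = f A (h' α (p α)).1 := hmem
    by_cases hx : ∃ β, (p β).1 = (h' α (p α)).1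
    · obtain ⟨β, hβ⟩ := hx
      rw [← hβ, hfp] at hmem
      rcases lt_trichotomy β α with hlt | heq | hlt
      · have hc := (hp α).2 β hlt
        have hv : v A β = 0 ∨ v A β = 1 := by
          rcases β with k | z
          · exact Or.inl rfl
          · by_cases hz : z ∈ A <;> simp [v, hz]
        rcases hv with hv | hv
        · exact hc.2.2.1 (Prod.ext hβ.symm (by rw [hmem, hv, add_zero]))
        · exact hc.2.2.2.1 (Prod.ext hβ.symm (by rw [hmem, hv]))
      · subst heq
        refine hne j (p (Sum.inl j)) (hp (Sum.inl j)).1 (Prod.ext hβ.symm ?_)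
        exact hmem.trans (add_zero _)
      · exact ((hp β).2 α hlt).2.1 hβ
    · have hx' : ∃ β, (h' β (p β)).1 = (h' α (p α)).1 ∧
          ∀ γ, (h' γ (p γ)).1 = (h' α (p α)).1 → ¬ γ < β :=
        wellFounded_lt.has_min {β | (h' β (p β)).1 = (h' α (p α)).1} ⟨α, rfl⟩
      simp only [f, dif_neg hx, dif_pos hx'] at hmem
      obtain ⟨hβ1, hβmin⟩ := hx'.choose_spec
      set β := hx'.choose
      have hβ2 : ¬ α < β := hβmin α rfl
      rcases (not_lt.1 hβ2).lt_or_eq with hlt | heq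
      · exact ((hp α).2 β hlt).2.2.2.2 (Prod.ext hβ1.symm hmem)
      · rw [heq] at hmem
        linarith

/-! ### Coding continuous maps by sequences -/

/-- The map sending `p` to the limit of `(u n).2` as `(u n).1` tends to `p`. -/
noncomputable def limExtension (u : ℕ → (ℝ × ℝ) × (ℝ × ℝ)) (p : ℝ × ℝ) : ℝ × ℝ :=
  limUnder (comap (fun n => (u n).1) (𝓝 p)) fun n => (u n).2

theorem exists_limExtension_eq {Γ : Set (ℝ × ℝ)} {h : Γ → ℝ × ℝ} (hh : Continuous h) :
    ∃ u, ∀ p : Γ, limExtension u p = h p := by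
  rcases isEmpty_or_nonempty Γ with hΓ | hΓ
  · exact ⟨fun _ => 0, fun p => hΓ.elim p⟩
  let d := TopologicalSpace.denseSeq Γ
  refine ⟨fun n => (d n, h (d n)), fun p => ?_⟩
  have hcomap : comap (fun n => (d n : ℝ × ℝ)) (𝓝 (p : ℝ × ℝ)) = comap d (𝓝 p) := by
    rw [nhds_subtype_eq_comap, comap_comap]
    rfl
  have hne : (comap d (𝓝 p)).NeBot := by
    rw [comap_neBot_iff]
    intro t ht
    obtain ⟨y, hy, n, rfl⟩ :=
      mem_closure_iff_nhds.1 (TopologicalSpace.denseRange_denseSeq Γ p) t ht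
    exact ⟨n, hy⟩
  unfold limExtension
  simp only [hcomap]
  exact ((hh.tendsto p).comp tendsto_comap).limUnder_eq

theorem mk_nat_arrow_eq_continuum {X : Type} (hX : #X = 𝔠) : #(ℕ → X) = 𝔠 := by
  rw [← power_def, hX, mk_nat, continuum_power_aleph0]

theorem mk_real_prod_real : #(ℝ × ℝ) = 𝔠 := by
  simp [mk_prod, mk_real]

theorem exists_closure_range_eq {K : Set (ℝ × ℝ)} (hK : IsClosed K) (hne : K.Nonempty) :
    ∃ s : ℕ → ℝ × ℝ, closure (range s) = K := by
  have := hne.to_subtype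
  refine ⟨fun n => TopologicalSpace.denseSeq K n, ?_⟩
  have h := (TopologicalSpace.denseRange_denseSeq K).closure_range
  apply Subset.antisymm
  · exact closure_minimal (by rintro _ ⟨n, rfl⟩; exact Subtype.coe_prop _) hK
  · intro x hx
    have hx' : (⟨x, hx⟩ : K) ∈ closure (range (TopologicalSpace.denseSeq K)) := h ▸ mem_univ _
    rw [closure_subtype, ← range_comp] at hx'
    exact hx'

/-- A set meets all closed sets with large projection. -/
def MeetsClosed (Γ : Set (ℝ × ℝ)) : Prop :=
  ∀ K : Set (ℝ × ℝ), IsClosed K → 𝔠 ≤ #(Prod.fst '' K) → (Γ ∩ K).Nonempty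

theorem exists_injective_family : ∃ f : Set ℝ → ℝ → ℝ, Function.Injective f ∧
    (∀ A, MeetsClosed (realGraph (f A))) ∧
    ∀ (u : ℕ → (ℝ × ℝ) × (ℝ × ℝ)) (T : Set (ℝ × ℝ)), 𝔠 ≤ #T → InjOn Prod.fst T →
      InjOn (limExtension u) T → (∀ p ∈ T, limExtension u p ≠ p) →
      ∃ p, ∀ A, p ∈ realGraph (f A) ∧ limExtension u p ∉ realGraph (f A) := by
  let good : (ℕ → (ℝ × ℝ) × (ℝ × ℝ)) → Set (ℝ × ℝ) → Prop := fun u T =>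
    𝔠 ≤ #T ∧ InjOn Prod.fst T ∧ InjOn (limExtension u) T ∧ ∀ p ∈ T, limExtension u p ≠ p
  let large : (ℕ → ℝ × ℝ) → Prop := fun s => 𝔠 ≤ #(Prod.fst '' closure (range s))
  -- There may be more than 𝔠 sets `T`, so one is fixed per code; the resulting `p` need not lie in
  -- an arbitrary good `T`.
  choose T hT using fun u : {u // ∃ T, good u T} => u.2
  have htrans : ∀ s : {s // large s}, ∃ T ⊆ closure (range s.1), 𝔠 ≤ #T ∧ InjOn Prod.fst T := by
    intro s
    obtain ⟨T, hTs, hT⟩ := (surjOn_image Prod.fst (closure (range s.1))).exists_bijOn_subset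
    refine ⟨T, hTs, ?_, hT.injOn⟩
    rw [← mk_image_eq_of_injOn _ _ hT.injOn, hT.image_eq]
    exact s.2
  choose R hR using htrans
  -- For closed sets only membership of `p` matters; the shift merely supplies a fixed point free
  -- injection.
  let up : ℝ × ℝ → ℝ × ℝ := fun p => (p.1, p.2 + 1)
  have hup : Function.Injective up := fun p q hpq => by
    simp only [up, Prod.mk.injEq, add_left_inj] at hpq
    exact Prod.ext hpq.1 hpq.2
  have hup' : ∀ p, up p ≠ p := fun p hp => by
    have := congrArg Prod.snd hp
    simp [up] at this
  have hJ : #({u // ∃ T, good u T} ⊕ {s // large s}) ≤ 𝔠 := by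
    rw [mk_sum, lift_id, lift_id]
    refine (add_le_add (mk_subtype_le _) (mk_subtype_le _)).trans ?_
    rw [mk_nat_arrow_eq_continuum mk_real_prod_real, mk_nat_arrow_eq_continuum
      (by rw [mk_prod, lift_id, mk_real_prod_real, continuum_mul_self]), continuum_add_self]
  obtain ⟨f, hf, p, hp⟩ := exists_injective_family_diagonalizing hJ (Sum.elim T R)
    (Sum.elim (fun u => limExtension u.1) fun _ => up)
    (by rintro (u | s); exacts [(hT u).1, (hR s).2.1])
    (by rintro (u | s); exacts [(hT u).2.1, (hR s).2.2])
    (by rintro (u | s); exacts [(hT u).2.2.1, hup.injOn])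
    (by rintro (u | s); exacts [(hT u).2.2.2, fun p _ => hup' p])
  refine ⟨f, hf, fun A K hK hcard => ?_, fun u S h1 h2 h3 h4 => ?_⟩
  · have hne : K.Nonempty := by
      rw [nonempty_iff_ne_empty]
      rintro rfl
      simp [continuum_ne_zero] at hcard
    obtain ⟨s, rfl⟩ := exists_closure_range_eq hK hne
    obtain ⟨hmem, hgraph⟩ := hp (Sum.inr ⟨s, hcard⟩)
    exact ⟨_, (hgraph A).1, (hR ⟨s, hcard⟩).1 hmem⟩
  · exact ⟨_, (hp (Sum.inl ⟨u, S, h1, h2, h3, h4⟩)).2⟩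

/-! ### Massiveness and connectedness -/

theorem continuum_le_mk_of_isClosed_of_not_countable {X : Type} [TopologicalSpace X]
    [PolishSpace X] {C : Set X} (hC : IsClosed C) (hunc : ¬ C.Countable) : 𝔠 ≤ #C := by
  obtain ⟨φ, hφ, -, hinj⟩ := hC.exists_nat_bool_injection_of_not_countable hunc
  have h := mk_le_of_injective (f := fun x => (⟨φ x, hφ (mem_range_self x)⟩ : C))
    fun x y hxy => hinj (congrArg Subtype.val hxy)
  simpa using h

/-- A compact set of positive measure cannot have a countable projection, as vertical lines are
null. -/
theorem MeetsClosed.isMassive {Γ : Set (ℝ × ℝ)} (hΓ : MeetsClosed Γ) : IsMassive Γ := by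
  intro L hL hpos
  obtain ⟨M, hML, hM, hae⟩ := hL.exists_measurable_subset_ae_eq
  rw [← measure_congr hae] at hpos
  obtain ⟨K, hKM, hK, hKpos⟩ := hM.exists_lt_isCompact hpos
  refine (hΓ K hK.isClosed (continuum_le_mk_of_isClosed_of_not_countable
    (hK.image continuous_fst).isClosed fun hcount => hKpos.ne' ?_)).mono
    (inter_subset_inter_right _ (hKM.trans hML))
  refine measure_mono_null (subset_preimage_image Prod.fst K) ?_
  exact Measure.quasiMeasurePreserving_fst.preimage_null (hcount.measure_zero volume)

theorem IsMassive.dense {Γ : Set (ℝ × ℝ)} (hΓ : IsMassive Γ) : Dense Γ := by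
  rw [dense_iff_inter_open]
  intro U hU hne
  rw [inter_comm]
  exact hΓ U hU.measurableSet.nullMeasurableSet (hU.measure_pos volume hne)

theorem continuum_le_mk_of_Ioo_subset {a b : ℝ} (hab : a < b) {s : Set ℝ} (hs : Ioo a b ⊆ s) :
    𝔠 ≤ #s :=
  (mk_Ioo_real hab).symm.le.trans (mk_le_mk_of_subset hs)

/-- A graph meeting all closed sets with large projection is connected. -/
theorem isConnected_realGraph_of_meetsClosed {f : ℝ → ℝ} (hf : MeetsClosed (realGraph f)) :
    IsConnected (realGraph f) := by
  refine ⟨⟨(0, f 0), rfl⟩, fun U V hU hV hcov hUne hVne => ?_⟩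
  by_contra hdisj
  have hd := hf.isMassive.dense
  have hUV : Disjoint U V := by
    rw [disjoint_iff_inter_eq_empty, ← not_nonempty_iff_eq_empty]
    intro hne
    obtain ⟨x, hx, hxΓ⟩ := hd.inter_open_nonempty _ (hU.inter hV) hne
    exact hdisj ⟨x, hxΓ, hx⟩
  let line : ℝ → Set (ℝ × ℝ) := fun x => range fun y => (x, y)
  have hline : ∀ x, IsPreconnected (line x) := fun x =>
    isPreconnected_range (by fun_prop)
  have hside : ∀ x, line x ⊆ U ∪ V → line x ⊆ U ∨ line x ⊆ V := fun x hx =>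
    (hline x).subset_or_subset hU hV hUV hx
  -- Otherwise the complement of `U ∪ V` projects onto an interval, and the graph meets it.
  have hgood : ∀ W : Set ℝ, IsOpen W → W.Nonempty → ∃ x ∈ W, line x ⊆ U ∪ V := by
    intro W hW hWne
    by_contra! hbad
    obtain ⟨x, hx⟩ := hWne
    obtain ⟨a, b, hab, habW⟩ := mem_nhds_iff_exists_Ioo_subset.1 (hW.mem_nhds hx)
    have hsub : Ioo a b ⊆ Prod.fst '' (U ∪ V)ᶜ := by
      intro z hz
      obtain ⟨_, ⟨y, rfl⟩, hy⟩ := not_subset.1 (hbad z (habW hz))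
      exact ⟨(z, y), hy, rfl⟩
    obtain ⟨q, hqΓ, hq⟩ := hf _ (hU.union hV).isClosed_compl
      (continuum_le_mk_of_Ioo_subset (hab.1.trans hab.2) hsub)
    exact hq (hcov hqΓ)
  have hmeet : ∀ {U V : Set (ℝ × ℝ)}, IsOpen U → IsOpen V → Disjoint U V →
      (∀ W : Set ℝ, IsOpen W → W.Nonempty → ∃ x ∈ W, line x ⊆ U ∨ line x ⊆ V) →
      (realGraph f ∩ U).Nonempty → (closure {x | line x ⊆ U}).Nonempty := by
    rintro U V hU hV hUV hgood ⟨⟨x, y⟩, -, hq⟩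
    obtain ⟨W, Y, hW, hY, hx, hy, hWY⟩ := isOpen_prod_iff.1 hU x y hq
    obtain ⟨z, hz, hzU | hzV⟩ := hgood W hW ⟨x, hx⟩
    · exact ⟨z, subset_closure hzU⟩
    · exact absurd (hzV ⟨y, rfl⟩) (disjoint_left.1 hUV (hWY ⟨hz, hy⟩))
  have hgood' : ∀ W : Set ℝ, IsOpen W → W.Nonempty → ∃ x ∈ W, line x ⊆ U ∨ line x ⊆ V :=
    fun W hW hWne => (hgood W hW hWne).imp fun x hx => ⟨hx.1, hside x hx.2⟩
  have hU' := hmeet hU hV hUV hgood' hUne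
  have hV' := hmeet hV hU hUV.symm
    (fun W hW hWne => (hgood' W hW hWne).imp fun x hx => ⟨hx.1, hx.2.symm⟩) hVne
  have hcover : (univ : Set ℝ) ⊆ closure {x | line x ⊆ U} ∪ closure {x | line x ⊆ V} := by
    intro x _
    rw [← closure_union, mem_closure_iff]
    intro W hW hx
    exact hgood' W hW ⟨x, hx⟩
  -- Some `x` is a limit of lines in `U` and of lines in `V`, so `(x, f x)` can lie in neither open
  -- set.
  obtain ⟨x, -, hxU, hxV⟩ := isPreconnected_closed_iff.1 isPreconnected_univ _ _ isClosed_closure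
    isClosed_closure hcover (by simpa using hU') (by simpa using hV')
  have hcontra : ∀ {U V : Set (ℝ × ℝ)}, IsOpen U → Disjoint U V →
      x ∈ closure {x | line x ⊆ V} → (x, f x) ∉ U := by
    intro U V hU hUV hx hq
    obtain ⟨W, Y, hW, -, hxW, hy, hWY⟩ := isOpen_prod_iff.1 hU x (f x) hq
    obtain ⟨z, hz, hzV⟩ := mem_closure_iff.1 hx W hW hxW
    exact disjoint_left.1 hUV (hWY ⟨hz, hy⟩) (hzV ⟨f x, rfl⟩)
  rcases hcov (show (x, f x) ∈ realGraph f from rfl) with hq | hq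
  · exact hcontra hU hUV hxV hq
  · exact hcontra hV hUV.symm hxU hq

/-! ### Incomparability -/

theorem injOn_fst_realGraph (f : ℝ → ℝ) : InjOn Prod.fst (realGraph f) := by
  intro p hp q hq hpq
  refine Prod.ext hpq ?_
  rw [show p.2 = f p.1 from hp, show q.2 = f q.1 from hq, hpq]

theorem eq_of_realGraph_subset {f g : ℝ → ℝ} (h : realGraph f ⊆ realGraph g) :
    realGraph f = realGraph g := by
  refine h.antisymm fun p hp => ?_
  have hx : f p.1 = g p.1 := h (show (p.1, f p.1) ∈ realGraph f from rfl)
  exact Eq.trans hp hx.symm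

/-- The graph meets every horizontal segment across a box inside `U`, and distinct heights give
distinct points. -/
theorem MeetsClosed.continuum_le_mk_inter {Γ U : Set (ℝ × ℝ)} (hΓ : MeetsClosed Γ)
    (hU : IsOpen U) (hne : U.Nonempty) : 𝔠 ≤ #(Γ ∩ U : Set (ℝ × ℝ)) := by
  obtain ⟨⟨x, y⟩, hp⟩ := hne
  obtain ⟨W, Y, hW, hY, hx, hy, hWY⟩ := isOpen_prod_iff.1 hU x y hp
  obtain ⟨a, b, ⟨ha, hb⟩, hab⟩ := mem_nhds_iff_exists_Ioo_subset.1 (hW.mem_nhds hx)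
  obtain ⟨c, d, ⟨hc, hd⟩, hcd⟩ := mem_nhds_iff_exists_Ioo_subset.1 (hY.mem_nhds hy)
  obtain ⟨a', ha', ha''⟩ := exists_between ha
  obtain ⟨b', hb', hb''⟩ := exists_between hb
  have hsub : Ioo c d ⊆ Prod.snd '' (Γ ∩ U) := by
    intro t ht
    have hK : IsClosed (Icc a' b' ×ˢ {t} : Set (ℝ × ℝ)) := isClosed_Icc.prod isClosed_singleton
    obtain ⟨⟨z, t'⟩, hqΓ, hz, rfl⟩ := hΓ _ hK (continuum_le_mk_of_Ioo_subset (ha''.trans hb')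
      fun z hz => ⟨(z, t), ⟨Ioo_subset_Icc_self hz, rfl⟩, rfl⟩)
    exact ⟨_, ⟨hqΓ, hWY ⟨hab ⟨ha'.trans_le hz.1, hz.2.trans_lt hb''⟩, hcd ht⟩⟩, rfl⟩
  exact (continuum_le_mk_of_Ioo_subset (hc.trans hd) hsub).trans mk_image_le

theorem theorem1 :
    ∃ 𝓕 : Set (ℝ → ℝ),
      #𝓕 = 2 ^ 𝔠 ∧
      (∀ f ∈ 𝓕, IsConnected (realGraph f) ∧ Dense (realGraph f) ∧ IsMassive (realGraph f)) ∧
      Incomparable (fun f : 𝓕 => realGraph (f : ℝ → ℝ)) := by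
  obtain ⟨f, hf, hmeets, hdiag⟩ := exists_injective_family
  refine ⟨range f, ?_, ?_, ?_⟩
  · rw [mk_range_eq f hf, mk_set, mk_real]
  · rintro _ ⟨A, rfl⟩
    exact ⟨isConnected_realGraph_of_meetsClosed (hmeets A), (hmeets A).isMassive.dense,
      (hmeets A).isMassive⟩
  · rintro ⟨_, A, rfl⟩ ⟨_, B, rfl⟩ S hS ⟨e⟩
    change realGraph (f A) = S ∧ S = realGraph (f B)
    change S ⊆ realGraph (f B) at hS
    change realGraph (f A) ≃ₜ S at e
    by_cases hid : ∀ p, (e p : ℝ × ℝ) = p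
    · have hAS : realGraph (f A) = S := by
        ext p
        constructor
        · intro hp
          rw [← show (e ⟨p, hp⟩ : ℝ × ℝ) = p from hid ⟨p, hp⟩]
          exact (e ⟨p, hp⟩).2
        · intro hp
          have h := hid (e.symm ⟨p, hp⟩)
          rw [e.apply_symm_apply] at h
          exact (show p = _ from h) ▸ (e.symm ⟨p, hp⟩).2
      exact ⟨hAS, hAS.symm.trans (eq_of_realGraph_subset (hAS ▸ hS))⟩
    · exfalso
      push Not at hid
      obtain ⟨p₀, hp₀⟩ := hid
      have he : Continuous fun p => (e p : ℝ × ℝ) := continuous_subtype_val.comp e.continuous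
      obtain ⟨u, hu⟩ := exists_limExtension_eq he
      obtain ⟨U, hU, hUeq⟩ :=
        isOpen_induced_iff.1 (isOpen_ne_fun he (continuous_subtype_val (p := (· ∈ realGraph (f A)))))
      have hmemU : ∀ p : realGraph (f A), (p : ℝ × ℝ) ∈ U ↔ (e p : ℝ × ℝ) ≠ p := fun p =>
        Set.ext_iff.1 hUeq p
      obtain ⟨p, hp⟩ := hdiag u (realGraph (f A) ∩ U)
        ((hmeets A).continuum_le_mk_inter hU ⟨p₀, (hmemU p₀).2 hp₀⟩)
        ((injOn_fst_realGraph _).mono inter_subset_left)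
        (by
          intro p hp q hq hpq
          rw [hu ⟨p, hp.1⟩, hu ⟨q, hq.1⟩] at hpq
          exact congrArg Subtype.val (e.injective (Subtype.ext hpq)))
        (by
          intro p hp
          rw [hu ⟨p, hp.1⟩]
          exact (hmemU ⟨p, hp.1⟩).1 hp.2)
      refine (hp B).2 ?_
      rw [hu ⟨p, (hp A).1⟩]
      exact hS (e ⟨p, (hp A).1⟩).2
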